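/- Let $K$ be a field of characteristic zero with commuting derivations $\Delta=\{\delta_1,\dots,\delta_m\}$ and let $F\subseteq K$ be a $\Delta$-subfield (for instance, $K$ a sufficiently saturated differentially closed field and $F$ small). A $\Delta$-variety over $F$ in $K^n$ is the set of common zeros in $K^n$ of a set of $\Delta$-polynomials over $F$ in $n$ variables. It is $F$-irreducible if it is nonempty and, whenever it is contained in the union of two $\Delta$-varieties over $F$, it is contained in one of them. A point $c\in X$ is generic in $X$ (over $F$) if $X$ is the smallest $\Delta$-variety over $F$ containing $c$. For $c=(c_1,\dots,c_n)\in K^n$ and $t\ge 0$ let $$\nabla_t c=\big(\delta_1^{e_1}\cdots\delta_m^{e_m}c_i:\ 1\le i\le n,\ e_1+\cdots+e_m\le t\big).$$ For $F$-irreducible $\Delta$-varieties $Y\subseteq X$ over $F$, say that $Y$ has codimension one in $X$ if $X$ and $Y$ have generic points and, for generic $x\in X$ and $y\in Y$, $\operatorname{trdeg}_F F(\nabla_t y)=\operatorname{trdeg}_F F(\nabla_t x)-1$ for all sufficiently large $t$ (this does not depend on the choice of $x$ and $y$). Let $X\subseteq K^n$ be an $F$-irreducible $\Delta$-variety over $F$.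 Then there is an integer $\ell\ge 0$ such that for every $F$-irreducible $\Delta$-subvariety $Y\subseteq X$ over $F$ of codimension one in $X$, and all generic points $x\in X$ and $y\in Y$, $$\operatorname{trdeg}_F F(\nabla_t y)=\operatorname{trdeg}_F F(\nabla_t x)-1\qquad\text{for all } t\ge \ell .$$ -/

import Mathlib

namespace DeltaGeometry

variable {K : Type*} [Field K] {m n : ℕ}

/-- The derivative operator `δ₁^{e₁} ⋯ δₘ^{eₘ}` attached to a multi-index `e`. -/
noncomputable def derivOp (δ : Fin m → Derivation ℤ K K) (e : Fin m → ℕ) : K →ₗ[ℤ] K :=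
  (List.ofFn fun k => ((δ k : K →ₗ[ℤ] K) : Module.End ℤ K) ^ e k).prod

/-- The ring `F{u₁, …, uₙ}` of `Δ`-polynomials over `F`, i.e. the polynomial ring in the algebraic
indeterminates `θ uᵢ`; the pair `(i, e)` stands for `δ₁^{e₁} ⋯ δₘ^{eₘ} uᵢ`. -/
abbrev DeltaPoly (F : Subfield K) (m n : ℕ) : Type _ :=
  MvPolynomial (Fin n × (Fin m → ℕ)) F

/-- The value `f(c)` of a `Δ`-polynomial `f` at a point `c` of `Kⁿ`. -/
noncomputable def evalAt (δ : Fin m → Derivation ℤ K K) (F : Subfield K) (c : Fin n → K)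
    (f : DeltaPoly F m n) : K :=
  MvPolynomial.aeval (fun p : Fin n × (Fin m → ℕ) => derivOp δ p.2 (c p.1)) f

/-- The common zeros in `Kⁿ` of a set of `Δ`-polynomials over `F`. -/
def zeroSet (δ : Fin m → Derivation ℤ K K) (F : Subfield K) (S : Set (DeltaPoly F m n)) :
    Set (Fin n → K) :=
  {c | ∀ f ∈ S, evalAt δ F c f = 0}

/-- `X ⊆ Kⁿ` is a `Δ`-variety over `F` (a Kolchin closed set over `F`). -/
def IsDeltaVariety (δ : Fin m → Derivation ℤ K K) (F : Subfield K) (X : Set (Fin n → K)) : Prop :=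
  ∃ S : Set (DeltaPoly F m n), X = zeroSet δ F S

/-- `X` is an `F`-irreducible `Δ`-variety over `F`: it is nonempty and is not covered by two
`Δ`-varieties over `F` neither of which contains it. -/
structure IsIrredDeltaVariety (δ : Fin m → Derivation ℤ K K) (F : Subfield K)
    (X : Set (Fin n → K)) : Prop where
  isDeltaVariety : IsDeltaVariety δ F X
  nonempty : X.Nonempty
  irreducible : ∀ A B : Set (Fin n → K), IsDeltaVariety δ F A → IsDeltaVariety δ F B →
    X ⊆ A ∪ B → X ⊆ A ∨ X ⊆ B

/-- The Kolchin locus of `c` over `F`: the smallest `Δ`-variety over `F` containing `c`. -/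
def kolchinLocus (δ : Fin m → Derivation ℤ K K) (F : Subfield K) (c : Fin n → K) :
    Set (Fin n → K) :=
  ⋂₀ {Z | IsDeltaVariety δ F Z ∧ c ∈ Z}

/-- `c` is a generic point of `X` over `F`. -/
def IsGenericPoint (δ : Fin m → Derivation ℤ K K) (F : Subfield K) (X : Set (Fin n → K))
    (c : Fin n → K) : Prop :=
  c ∈ X ∧ X = kolchinLocus δ F c

/-- The field `F(∇ₜ c)` generated over `F` by all `θ cᵢ` with `θ` of order at most `t`. -/
noncomputable def prolongationField (δ : Fin m → Derivation ℤ K K) (F : Subfield K) (t : ℕ)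
    (c : Fin n → K) : IntermediateField F K :=
  IntermediateField.adjoin F
    {a | ∃ (i : Fin n) (e : Fin m → ℕ), ∑ k, e k ≤ t ∧ a = derivOp δ e (c i)}

/-- The transcendence degree of `F(∇ₜ c)` over `F`. -/
noncomputable def prolongationTrdeg (δ : Fin m → Derivation ℤ K K) (F : Subfield K) (t : ℕ)
    (c : Fin n → K) : Cardinal :=
  Algebra.trdeg F (prolongationField δ F t c)

/-- `Y` has codimension one in `X` (both `F`-irreducible): for generic points `x` of `X` and `y` of
`Y`, `trdeg F(∇ₜ y) = trdeg F(∇ₜ x) - 1` for all sufficiently large `t`. The equation is written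
additively to avoid a truncated subtraction. -/
def IsCodimOne (δ : Fin m → Derivation ℤ K K) (F : Subfield K) (X Y : Set (Fin n → K)) : Prop :=
  Y ⊆ X ∧ ∃ x y, IsGenericPoint δ F X x ∧ IsGenericPoint δ F Y y ∧
    ∃ t₀ : ℕ, ∀ t ≥ t₀, prolongationTrdeg δ F t y + 1 = prolongationTrdeg δ F t x

end DeltaGeometry

/-!
Order the derivatives `θ cᵢ` of a point `c` by an orderly ranking and call `θ cᵢ` parametric if it
is transcendental over the field generated by its predecessors. The parametric derivatives of
order at most `t` form a transcendence basis of `F(∇ₜ c)`, so `trdeg F(∇ₜ c)` counts them.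
Differentiating an algebraic relation (in characteristic zero) shows that a derivative of a
non-parametric `θ cᵢ` is again non-parametric, hence the parametric derivatives form `n` lower
sets in `ℕᵐ`.

Lower sets of `ℕᵐ` are well-quasi-ordered by inclusion: each is a finite union of boxes with
possibly infinite sides, and Higman's lemma applies. Two comparable but distinct families of lower
sets have different counting functions for all large `t`, so the families whose counting function
is eventually a given one form an antichain, which is finite. The largest of their finitely many
thresholds is `ℓ`.
-/

namespace DeltaGeometry

section LowerSets

theorem wellFoundedLT_lowerSet {α : Type*} [LinearOrder α] [WellFoundedLT α] :
    WellFoundedLT (LowerSet α) := by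
  refine ⟨RelEmbedding.wellFounded_iff_isEmpty.2 ⟨fun D => ?_⟩⟩
  have hD : ∀ k, ∃ a ∈ D k, a ∉ D (k + 1) := fun k =>
    Set.not_subset.1 (D.map_rel_iff.2 k.lt_succ_self).not_ge
  choose a ha ha' using hD
  exact not_strictAnti_of_wellFoundedLT a <| strictAnti_nat_of_succ_lt fun k =>
    not_le.1 fun hle => ha' k ((D (k + 1)).lower hle (ha (k + 1)))

theorem wellQuasiOrdered_forall_mem_exists_mem {α : Type*} {r : α → α → Prop} [IsPreorder α r]
    (hr : WellQuasiOrdered r) :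
    WellQuasiOrdered fun l l' : List α => ∀ a ∈ l, ∃ b ∈ l', r a b := by
  have hdom : ∀ {l l' : List α}, l.SublistForall₂ r l' → ∀ a ∈ l, ∃ b ∈ l', r a b := by
    intro l l' h
    induction h with
    | nil => simp
    | cons hab _ ih => simpa using ⟨.inl hab, fun a ha => .inr (ih a ha)⟩
    | cons_right _ ih => exact fun a ha => (ih a ha).imp fun b hb => ⟨.tail _ hb.1, hb.2⟩
  intro l
  obtain ⟨i, j, hij, h⟩ := Set.PartiallyWellOrderedOn.partiallyWellOrderedOn_sublistForall₂ r
    (Set.partiallyWellOrderedOn_of_wellQuasiOrdered hr Set.univ) fun i => ⟨l i, by simp⟩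
  exact ⟨i, j, hij, hdom h⟩

variable {ι : Type*} {α : ι → Type*}

/-- The box with (possibly infinite) sides `w i`. -/
def box [∀ i, LE (α i)] (w : ∀ i, LowerSet (α i)) : LowerSet (∀ i, α i) where
  carrier := {e | ∀ i, e i ∈ w i}
  lower' _ _ hle he i := (w i).lower (hle i) (he i)

theorem box_mono [∀ i, LE (α i)] : Monotone (box (α := α)) :=
  fun _ _ h _ he i => h i (he i)

variable [Finite ι]

theorem exists_mem_box_of_mem_box_sSup [∀ i, LE (α i)] {c : Set (∀ i, LowerSet (α i))}
    (hc : IsChain (· ≤ ·) c) (hne : c.Nonempty) {e : ∀ i, α i} (he : e ∈ box (sSup c)) :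
    ∃ w ∈ c, e ∈ box w := by
  have hside : ∀ i, ∃ w : c, e i ∈ w.1 i := fun i => by
    simpa [sSup_apply] using he i
  choose w hw using hside
  have := hne.to_subtype
  obtain ⟨v, hv⟩ := hc.directedOn.directed_val.finite_le w
  exact ⟨v, v.2, fun i => hv i i (hw i)⟩

theorem exists_maximal_box_le [∀ i, Preorder (α i)] {D : LowerSet (∀ i, α i)} {e : ∀ i, α i}
    (he : e ∈ D) : ∃ w, Maximal (box · ≤ D) w ∧ e ∈ box w := by
  obtain ⟨w, hle, hw⟩ := zorn_le_nonempty₀ {w | box w ≤ D}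
    (fun c hcD hc v hv => ⟨sSup c, fun e he => by
      obtain ⟨w, hw, hew⟩ := exists_mem_box_of_mem_box_sSup hc ⟨v, hv⟩ he
      exact hcD hw hew, fun _ => le_sSup⟩)
    (fun i => LowerSet.Iic (e i)) (fun _ he' => D.lower he' he)
  exact ⟨w, hw, fun i => hle i le_rfl⟩

variable [∀ i, LinearOrder (α i)] [∀ i, WellFoundedLT (α i)]

theorem exists_list_box (D : LowerSet (∀ i, α i)) :
    ∃ l : List (∀ i, LowerSet (α i)), ∀ e, e ∈ D ↔ ∃ w ∈ l, e ∈ box w := by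
  have := fun i => wellFoundedLT_lowerSet (α := α i)
  have hfin : {w | Maximal (box · ≤ D) w}.Finite :=
    WellQuasiOrderedLE.finite_of_isAntichain (setOfPred_maximal_antichain _)
  refine ⟨hfin.toFinset.toList, fun e => ?_⟩
  simp only [Finset.mem_toList, Set.Finite.mem_toFinset, Set.mem_ofPred_eq]
  exact ⟨exists_maximal_box_le, fun ⟨w, hw, he⟩ => hw.prop he⟩

instance wellQuasiOrderedLE_lowerSet_pi : WellQuasiOrderedLE (LowerSet (∀ i, α i)) := by
  have := fun i => wellFoundedLT_lowerSet (α := α i)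
  refine ⟨fun D => ?_⟩
  choose l hl using fun k => exists_list_box (D k)
  obtain ⟨i, j, hij, h⟩ := wellQuasiOrdered_forall_mem_exists_mem wellQuasiOrdered_le l
  refine ⟨i, j, hij, fun e he => ?_⟩
  obtain ⟨w, hw, hew⟩ := (hl i e).1 he
  obtain ⟨v, hv, hwv⟩ := h w hw
  exact (hl j e).2 ⟨v, hv, box_mono hwv hew⟩

end LowerSets

section Threshold
open Filter

theorem finite_setOf_eventually_eq {P β τ : Type*} [PartialOrder P] [WellQuasiOrderedLE P]
    [Preorder β] {f : Filter τ} [f.NeBot] {N : P → τ → β}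
    (hN : ∀ D D', D < D' → ∀ᶠ t in f, N D t < N D' t) (g : τ → β) :
    {D | N D =ᶠ[f] g}.Finite := by
  refine WellQuasiOrderedLE.finite_of_isAntichain fun D hD D' hD' hne hle => ?_
  obtain ⟨t, hlt, h, h'⟩ := ((hN D D' (hle.lt_of_ne hne)).and (hD.and hD')).exists
  exact hlt.ne (h.trans h'.symm)

theorem exists_forall_ge_eq_of_eventuallyEq {P β τ : Type*} [PartialOrder P] [WellQuasiOrderedLE P]
    [Preorder β] [Preorder τ] [IsDirectedOrder τ] [Nonempty τ] {N : P → τ → β}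
    (hN : ∀ D D', D < D' → ∀ᶠ t in atTop, N D t < N D' t) (g : τ → β) :
    ∃ ℓ, ∀ D, N D =ᶠ[atTop] g → ∀ t ≥ ℓ, N D t = g t :=
  eventually_atTop.1 ((eventually_all_finite (finite_setOf_eventually_eq hN g)).2 fun _ h => h)
    |>.imp fun _ h D hD t ht => h t ht D hD

end Threshold

section Parametric

variable {F K ι α : Type*} [Field F] [Field K] [Algebra F K]

theorem trdeg_intermediateField_adjoin (s : Set K) :
    Algebra.trdeg F (IntermediateField.adjoin F s) = Algebra.trdeg F (Algebra.adjoin F s) := by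
  open scoped IntermediateField.algebraAdjoinAdjoin in
  rw [← trdeg_add_eq F (Algebra.adjoin F s) (A := IntermediateField.adjoin F s),
    trdeg_eq_zero (R := Algebra.adjoin F s), add_zero]

theorem trdeg_adjoin_range_le {v w : ι → K}
    (h : ∀ f : MvPolynomial ι F, MvPolynomial.aeval w f = 0 → MvPolynomial.aeval v f = 0) :
    Algebra.trdeg F (IntermediateField.adjoin F (Set.range v)) ≤
      Algebra.trdeg F (IntermediateField.adjoin F (Set.range w)) := by
  rw [trdeg_intermediateField_adjoin, trdeg_intermediateField_adjoin,
    Algebra.adjoin_range_eq_range_aeval, Algebra.adjoin_range_eq_range_aeval]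
  exact trdeg_le_of_surjective _ (AlgHom.liftOfSurjective_surjective
    _ (AlgHom.rangeRestrict_surjective _) (MvPolynomial.aeval v).rangeRestrict
    (fun f hf => Subtype.ext (h f (congrArg Subtype.val hf))) (AlgHom.rangeRestrict_surjective _))

theorem trdeg_adjoin_eq_mk {b s : Set K} (h : (AlgebraicIndependent.matroid F K).IsBasis b s) :
    Algebra.trdeg F (IntermediateField.adjoin F s) = Cardinal.mk b := by
  set E := IntermediateField.adjoin F s
  obtain ⟨hind, hbs, -⟩ := AlgebraicIndependent.matroid_isBasis_iff.1 h
  let y : b → E := fun p => ⟨p, IntermediateField.subset_adjoin F _ (hbs p.2)⟩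
  have hy : AlgebraicIndependent F y :=
    (AlgHom.algebraicIndependent_iff E.val Subtype.val_injective).1 hind
  have hmap : (Algebra.adjoin F (Set.range y)).map E.val = Algebra.adjoin F b := by
    rw [AlgHom.map_adjoin, ← Set.range_comp]
    exact congrArg _ Subtype.range_val
  refine (IsTranscendenceBasis.cardinalMk_eq_trdeg
    (hy.isTranscendenceBasis_iff_isAlgebraic.2 ⟨fun a => ?_⟩)).symm
  have ha : IsAlgebraic (Algebra.adjoin F b) (a : K) :=
    (AlgebraicIndependent.isAlgebraic_adjoin_iff_of_matroid_isBasis h).2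
      (IntermediateField.isAlgebraic_adjoin_iff.1 (isAlgebraic_algebraMap a))
  rw [← hmap] at ha
  exact ha.of_ringHom_of_comp_eq
    ((Algebra.adjoin F (Set.range y)).equivMapOfInjective E.val Subtype.val_injective) E.val
    (AlgEquiv.surjective _) Subtype.val_injective rfl

theorem algebraicIndepOn_of_finset {v : ι → K} {s : Set ι}
    (h : ∀ t : Finset ι, ↑t ⊆ s → AlgebraicIndepOn F v t) : AlgebraicIndepOn F v s :=
  algebraicIndependent_comp_subtype.2 fun f hf =>
    algebraicIndependent_comp_subtype.1 (h f.vars (MvPolynomial.mem_supported.1 hf)) f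
      f.mem_supported_vars

/-- The indices at which a family ranked by `rk` is transcendental over its predecessors. -/
def parametricSet (F : Type*) [Field F] [Algebra F K] [LT α] (rk : ι → α) (v : ι → K) : Set ι :=
  {p | Transcendental (Algebra.adjoin F (v '' {q | rk q < rk p})) (v p)}

theorem algebraicIndepOn_parametricSet [LinearOrder α] {rk : ι → α}
    (hrk : Function.Injective rk) (v : ι → K) : AlgebraicIndepOn F v (parametricSet F rk v) := by
  classical
  refine algebraicIndepOn_of_finset fun s => ?_
  induction s using Finset.induction_on_max_value rk with
  | empty => simpa using (algebraMap F K).injective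
  | insert a s ha hmax ih =>
    rw [Finset.coe_insert, Set.insert_subset_iff]
    rintro ⟨hap, hs⟩
    refine (ih hs).insert (hap.of_tower_top_of_subalgebra_le
      (Algebra.adjoin_mono (Set.image_mono fun q hq => ?_)))
    exact (hmax q hq).lt_of_ne fun h => ha (hrk h ▸ hq)

theorem isAlgebraic_adjoin_parametricSet_inter [LT α] [WellFoundedLT α] {rk : ι → α}
    (v : ι → K) {s : Set ι} (hs : ∀ p ∈ s, ∀ q, rk q < rk p → q ∈ s) {p : ι} (hp : p ∈ s) :
    IsAlgebraic (Algebra.adjoin F (v '' (parametricSet F rk v ∩ s))) (v p) := by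
  induction p using (InvImage.wf rk wellFounded_lt).induction with
  | _ p ih =>
  by_cases hpar : p ∈ parametricSet F rk v
  · exact isAlgebraic_algebraMap (⟨v p, Algebra.subset_adjoin ⟨p, ⟨hpar, hp⟩, rfl⟩⟩ :
      Algebra.adjoin F (v '' (parametricSet F rk v ∩ s)))
  · refine (not_not.1 hpar).adjoin_of_forall_isAlgebraic ?_
    rintro _ ⟨⟨q, hq, rfl⟩, -⟩
    exact ih q hq (hs p hp q hq)

theorem trdeg_adjoin_image_eq_ncard [LinearOrder α] [WellFoundedLT α] {rk : ι → α}
    (hrk : Function.Injective rk) (v : ι → K) {s : Set ι}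
    (hs : ∀ p ∈ s, ∀ q, rk q < rk p → q ∈ s) (hfin : s.Finite) :
    Algebra.trdeg F (IntermediateField.adjoin F (v '' s)) = (parametricSet F rk v ∩ s).ncard := by
  have hind : AlgebraicIndepOn F v (parametricSet F rk v ∩ s) :=
    (algebraicIndepOn_parametricSet hrk v).mono Set.inter_subset_left
  rw [trdeg_adjoin_eq_mk (b := v '' (parametricSet F rk v ∩ s))
    (AlgebraicIndependent.matroid_isBasis_iff.2 ⟨hind.image, ?_, ?_⟩),
    ← Set.cast_ncard ((hfin.inter_of_right _).image _), Set.InjOn.ncard_image ?_]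
  · exact Set.injOn_iff_injective.2 hind.injective
  · exact Set.image_mono Set.inter_subset_right
  · rintro _ ⟨p, hp, rfl⟩
    exact isAlgebraic_adjoin_parametricSet_inter v hs hp

end Parametric

section Derivations

variable {F K : Type*} [Field F] [Field K] [Algebra F K]

/-- The elements of the intermediate field `M` which the derivation `D` maps into `M`. -/
def derivStable (D : Derivation ℤ K K) (M : IntermediateField F K)
    (hD : ∀ a : F, D (algebraMap F K a) ∈ M) : IntermediateField F K where
  carrier := {a | a ∈ M ∧ D a ∈ M}
  mul_mem' := fun ⟨ha, ha'⟩ ⟨hb, hb'⟩ => ⟨M.mul_mem ha hb, by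
    rw [D.leibniz]
    exact M.add_mem (M.mul_mem ha hb') (M.mul_mem hb ha')⟩
  add_mem' := fun ⟨ha, ha'⟩ ⟨hb, hb'⟩ => ⟨M.add_mem ha hb, by
    rw [map_add]
    exact M.add_mem ha' hb'⟩
  algebraMap_mem' := fun a => ⟨M.algebraMap_mem a, hD a⟩
  inv_mem' := fun a ⟨ha, ha'⟩ => ⟨M.inv_mem ha, by
    rw [D.leibniz_inv]
    exact M.mul_mem (M.neg_mem (pow_mem (M.inv_mem ha) 2)) ha'⟩

variable {D : Derivation ℤ K K} {M : IntermediateField F K}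
  {hD : ∀ a : F, D (algebraMap F K a) ∈ M}

theorem aeval_derivStable_mem {a : K} (ha : a ∈ M) (p : Polynomial (derivStable D M hD)) :
    Polynomial.aeval a p ∈ M := by
  rw [Polynomial.aeval_eq_sum_range]
  exact M.sum_mem fun i _ => M.mul_mem (p.coeff i).2.1 (pow_mem ha i)

theorem derivation_aeval_sub_mem {a : K} (ha : a ∈ M) (p : Polynomial (derivStable D M hD)) :
    D (Polynomial.aeval a p) - Polynomial.aeval a (Polynomial.derivative p) * D a ∈ M := by
  induction p using Polynomial.induction_on' with
  | add p q hp hq =>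
    simpa only [map_add, add_mul, add_sub_add_comm] using M.add_mem hp hq
  | monomial k c =>
    have hc : algebraMap (derivStable D M hD) K c = c := rfl
    have hmem : a ^ k * D c ∈ M := M.mul_mem (pow_mem ha k) c.2.2
    simpa [Polynomial.derivative_monomial, Polynomial.aeval_monomial, D.leibniz, D.leibniz_pow,
      mul_assoc, hc] using hmem

theorem derivation_mem_of_isAlgebraic [CharZero K] {a : K} (ha : a ∈ M)
    (halg : IsAlgebraic (derivStable D M hD) a) : D a ∈ M := by
  set p := minpoly (derivStable D M hD) a
  have hne : Polynomial.aeval a (Polynomial.derivative p) ≠ 0 :=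
    (minpoly.irreducible halg.isIntegral).separable.aeval_derivative_ne_zero (minpoly.aeval _ a)
  have hmem : Polynomial.aeval a (Polynomial.derivative p) * D a ∈ M := by
    simpa [p, minpoly.aeval] using derivation_aeval_sub_mem ha p
  rw [← inv_mul_cancel_left₀ hne (D a)]
  exact M.mul_mem (M.inv_mem (aeval_derivStable_mem ha _)) hmem

theorem mul_prod_ofFn_pow {M : Type*} [Monoid M] {m : ℕ} (f : Fin m → M)
    (hf : ∀ i j, Commute (f i) (f j)) (e : Fin m → ℕ) (k : Fin m) :
    f k * (List.ofFn fun i => f i ^ e i).prod =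
      (List.ofFn fun i => f i ^ (e + Pi.single k 1 : Fin m → ℕ) i).prod := by
  induction m with
  | zero => exact k.elim0
  | succ m ih =>
    simp only [List.ofFn_succ, List.prod_cons]
    cases k using Fin.cases with
    | zero =>
      simp [pow_succ', mul_assoc, Fin.succ_ne_zero]
    | succ k =>
      rw [← mul_assoc, ((hf k.succ 0).pow_right _).eq, mul_assoc,
        ih (fun i => f i.succ) (fun i j => hf _ _) (fun i => e i.succ) k]
      simp [Pi.single_apply, (Fin.succ_ne_zero k).symm]

theorem derivOp_add_single {m : ℕ} {δ : Fin m → Derivation ℤ K K}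
    (hcomm : ∀ i j a, δ i (δ j a) = δ j (δ i a)) (e : Fin m → ℕ) (k : Fin m) (a : K) :
    δ k (derivOp δ e a) = derivOp δ (e + Pi.single k 1) a := by
  have h := mul_prod_ofFn_pow (fun k => ((δ k : K →ₗ[ℤ] K) : Module.End ℤ K))
    (fun i j => LinearMap.ext fun a => hcomm i j a) e k
  exact LinearMap.congr_fun h a

end Derivations

section Ranking

variable {m n : ℕ}

/-- The degree-lexicographic rank of a multi-index. -/
def degLex (e : Fin m → ℕ) : ℕ ×ₗ Lex (Fin m → ℕ) :=
  toLex (∑ k, e k, toLex e)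

/-- The orderly ranking of the derivatives `δ₁^{e₁} ⋯ δₘ^{eₘ} uᵢ`, encoded as pairs `(i, e)`, which
compares them by order first. -/
def rank (p : Fin n × (Fin m → ℕ)) : (ℕ ×ₗ Lex (Fin m → ℕ)) ×ₗ Fin n :=
  toLex (degLex p.2, p.1)

/-- The index of the derivative with respect to `δ k`. -/
def shift (k : Fin m) (p : Fin n × (Fin m → ℕ)) : Fin n × (Fin m → ℕ) :=
  (p.1, p.2 + Pi.single k 1)

theorem degLex_add (e f : Fin m → ℕ) : degLex (e + f) = degLex e + degLex f := by
  simp only [degLex, Pi.add_apply, Finset.sum_add_distrib]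
  rfl

theorem degLex_single_pos (k : Fin m) : 0 < degLex (Pi.single k 1) :=
  Prod.Lex.toLex_lt_toLex.2 (.inl (by simp))

theorem sum_le_sum_of_rank_lt {p q : Fin n × (Fin m → ℕ)} (h : rank q < rank p) :
    ∑ k, q.2 k ≤ ∑ k, p.2 k := by
  simp only [rank, degLex, Prod.Lex.toLex_lt_toLex, EmbeddingLike.apply_eq_iff_eq,
    Prod.mk.injEq] at h
  omega

theorem rank_injective : Function.Injective (rank (m := m) (n := n)) := by
  rintro ⟨i, e⟩ ⟨j, f⟩ h
  simp_all [rank, degLex]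

theorem rank_lt_rank_shift (k : Fin m) (p : Fin n × (Fin m → ℕ)) : rank p < rank (shift k p) := by
  refine Prod.Lex.toLex_lt_toLex.2 (.inl ?_)
  rw [shift, degLex_add]
  exact lt_add_of_pos_right _ (degLex_single_pos k)

theorem rank_shift_lt_rank_shift (k : Fin m) {p q : Fin n × (Fin m → ℕ)} (h : rank q < rank p) :
    rank (shift k q) < rank (shift k p) := by
  simpa [rank, shift, degLex_add, Prod.Lex.toLex_lt_toLex] using h

theorem isLowerSet_of_forall_add_single_mem {S : Set (Fin m → ℕ)}
    (h : ∀ e k, e + Pi.single k 1 ∈ S → e ∈ S) : IsLowerSet S := by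
  refine Set.antitone_mem.1 ((antitone_iff_forall_covBy _).2 fun e e' hcov => ?_)
  obtain ⟨k, x, hx, rfl⟩ := Pi.covBy_iff_exists_right_eq.1 hcov
  have hupd : Function.update e k x = e + Pi.single k 1 := by
    rw [← Nat.covBy_iff_add_one_eq.1 hx]
    ext j
    obtain rfl | hj := eq_or_ne j k <;> simp [*]
  rw [hupd]
  exact h e k

end Ranking

section HilbertFunction

variable {m n : ℕ}

/-- The indices `(i, e)` of the derivatives of order at most `t`. -/
def indicesUpTo (m n t : ℕ) : Set (Fin n × (Fin m → ℕ)) :=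
  {p | ∑ k, p.2 k ≤ t}

theorem finite_indicesUpTo (m n t : ℕ) : (indicesUpTo m n t).Finite := by
  refine ((Set.finite_univ (α := Fin n)).prod (Set.finite_Iic (fun _ : Fin m => t))).subset ?_
  rintro ⟨i, e⟩ he
  exact ⟨trivial, fun k => (Finset.single_le_sum (fun _ _ => Nat.zero_le _)
    (Finset.mem_univ k)).trans he⟩

/-- The number of pairs `(i, e)` of order at most `t` with `e ∈ D i`. -/
noncomputable def hilbertFunction (D : Fin n → LowerSet (Fin m → ℕ)) (t : ℕ) : ℕ :=
  ({p | p.2 ∈ D p.1} ∩ indicesUpTo m n t).ncard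

theorem eventually_hilbertFunction_lt {D D' : Fin n → LowerSet (Fin m → ℕ)} (h : D < D') :
    ∀ᶠ t in Filter.atTop, hilbertFunction D t < hilbertFunction D' t := by
  obtain ⟨hle, i, hi⟩ := Pi.lt_def.1 h
  obtain ⟨e, he', he⟩ : ∃ e ∈ D' i, e ∉ D i := Set.not_subset.1 hi.not_ge
  filter_upwards [Filter.eventually_ge_atTop (∑ k, e k)] with t ht
  refine Set.ncard_lt_ncard ⟨fun p hp => ⟨hle p.1 hp.1, hp.2⟩, fun hsub => ?_⟩
    ((finite_indicesUpTo m n t).inter_of_right _)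
  have hmem : (i, e) ∈ {p : Fin n × (Fin m → ℕ) | p.2 ∈ D p.1} ∩ indicesUpTo m n t :=
    hsub ⟨he', ht⟩
  exact he hmem.1

end HilbertFunction

section Points

variable {K : Type*} [Field K] {m n : ℕ} {δ : Fin m → Derivation ℤ K K} {F : Subfield K}

/-- The family `(θ cᵢ)` of all derivatives of the coordinates of `c`. -/
noncomputable def jet (δ : Fin m → Derivation ℤ K K) (c : Fin n → K)
    (p : Fin n × (Fin m → ℕ)) : K :=
  derivOp δ p.2 (c p.1)

theorem derivation_jet (hcomm : ∀ i j a, δ i (δ j a) = δ j (δ i a)) (k : Fin m) (c : Fin n → K)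
    (p : Fin n × (Fin m → ℕ)) : δ k (jet δ c p) = jet δ c (shift k p) :=
  derivOp_add_single hcomm p.2 k (c p.1)

theorem prolongationField_eq (δ : Fin m → Derivation ℤ K K) (F : Subfield K) (t : ℕ)
    (c : Fin n → K) :
    prolongationField δ F t c = IntermediateField.adjoin F (jet δ c '' indicesUpTo m n t) := by
  rw [prolongationField]
  congr 1
  ext a
  simp [jet, indicesUpTo, eq_comm]

theorem prolongationTrdeg_eq_ncard (δ : Fin m → Derivation ℤ K K) (F : Subfield K) (t : ℕ)
    (c : Fin n → K) : prolongationTrdeg δ F t c =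
      (parametricSet F rank (jet δ c) ∩ indicesUpTo m n t).ncard := by
  rw [prolongationTrdeg, prolongationField_eq]
  exact trdeg_adjoin_image_eq_ncard rank_injective _
    (fun p hp q hq => (sum_le_sum_of_rank_lt hq).trans hp) (finite_indicesUpTo m n t)

theorem mem_parametricSet_jet_of_shift_mem [CharZero K]
    (hcomm : ∀ i j a, δ i (δ j a) = δ j (δ i a)) (hF : ∀ i, ∀ a ∈ F, δ i a ∈ F)
    (c : Fin n → K) {p : Fin n × (Fin m → ℕ)} {k : Fin m}
    (hp : shift k p ∈ parametricSet F rank (jet δ c)) : p ∈ parametricSet F rank (jet δ c) := by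
  set M := IntermediateField.adjoin F (jet δ c '' {q | rank q < rank (shift k p)})
  have hmem : ∀ q, rank q < rank (shift k p) → jet δ c q ∈ M := fun q hq =>
    IntermediateField.subset_adjoin F _ ⟨q, hq, rfl⟩
  have hD : ∀ a : F, δ k (algebraMap F K a) ∈ M := fun a => M.algebraMap_mem ⟨δ k a, hF k a a.2⟩
  have hle : Algebra.adjoin F (jet δ c '' {q | rank q < rank p}) ≤
      (derivStable (δ k) M hD).toSubalgebra := by
    refine Algebra.adjoin_le ?_
    rintro _ ⟨q, hq, rfl⟩
    refine ⟨hmem q (lt_trans hq (rank_lt_rank_shift k p)), ?_⟩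
    rw [derivation_jet hcomm]
    exact hmem _ (rank_shift_lt_rank_shift k hq)
  refine fun halg => (IntermediateField.transcendental_adjoin_iff.2 hp) ?_
  have hshift : jet δ c (shift k p) ∈ M := by
    rw [← derivation_jet hcomm]
    exact derivation_mem_of_isAlgebraic (hmem p (rank_lt_rank_shift k p))
      (halg.tower_top_of_subalgebra_le hle)
  exact isAlgebraic_algebraMap (⟨_, hshift⟩ : M)

theorem isLowerSet_parametricSet_jet [CharZero K]
    (hcomm : ∀ i j a, δ i (δ j a) = δ j (δ i a)) (hF : ∀ i, ∀ a ∈ F, δ i a ∈ F)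
    (c : Fin n → K) (i : Fin n) : IsLowerSet {e | (i, e) ∈ parametricSet F rank (jet δ c)} :=
  isLowerSet_of_forall_add_single_mem fun e k he =>
    mem_parametricSet_jet_of_shift_mem (p := (i, e)) (k := k) hcomm hF c he

theorem exists_prolongationTrdeg_eq_hilbertFunction [CharZero K]
    (hcomm : ∀ i j a, δ i (δ j a) = δ j (δ i a)) (hF : ∀ i, ∀ a ∈ F, δ i a ∈ F)
    (c : Fin n → K) : ∃ D : Fin n → LowerSet (Fin m → ℕ),
      ∀ t, prolongationTrdeg δ F t c = hilbertFunction D t := by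
  refine ⟨fun i => ⟨_, isLowerSet_parametricSet_jet hcomm hF c i⟩, fun t => ?_⟩
  rw [prolongationTrdeg_eq_ncard]
  rfl

theorem exists_forall_ge_prolongationTrdeg_add_eq [CharZero K]
    (hcomm : ∀ i j a, δ i (δ j a) = δ j (δ i a)) (hF : ∀ i, ∀ a ∈ F, δ i a ∈ F)
    (d : ℕ → ℕ) (g : ℕ → Cardinal) : ∃ ℓ : ℕ, ∀ c : Fin n → K,
      (∀ᶠ t in Filter.atTop, prolongationTrdeg δ F t c + d t = g t) →
        ∀ t ≥ ℓ, prolongationTrdeg δ F t c + d t = g t := by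
  obtain ⟨ℓ, hℓ⟩ := exists_forall_ge_eq_of_eventuallyEq
    (N := fun (D : Fin n → LowerSet (Fin m → ℕ)) t => ((hilbertFunction D t + d t : ℕ) : Cardinal))
    (fun D D' h => (eventually_hilbertFunction_lt h).mono fun t ht => by
      exact_mod_cast Nat.add_lt_add_right ht (d t)) g
  refine ⟨ℓ, fun c => ?_⟩
  obtain ⟨D, hD⟩ := exists_prolongationTrdeg_eq_hilbertFunction hcomm hF c
  simp only [hD, ← Nat.cast_add]
  exact hℓ D

theorem IsGenericPoint.evalAt_eq_zero {X : Set (Fin n → K)} {x x' : Fin n → K}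
    (hx : IsGenericPoint δ F X x) (hx' : x' ∈ X) {f : DeltaPoly F m n}
    (hf : evalAt δ F x f = 0) : evalAt δ F x' f = 0 := by
  rw [hx.2] at hx'
  exact hx' (zeroSet δ F {f}) ⟨⟨{f}, rfl⟩, by simpa [zeroSet] using hf⟩ f rfl

theorem IsGenericPoint.prolongationTrdeg_le {X : Set (Fin n → K)} {x x' : Fin n → K}
    (hx : IsGenericPoint δ F X x) (hx' : x' ∈ X) (t : ℕ) :
    prolongationTrdeg δ F t x' ≤ prolongationTrdeg δ F t x := by
  rw [prolongationTrdeg, prolongationTrdeg, prolongationField_eq, prolongationField_eq,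
    Set.image_eq_range, Set.image_eq_range]
  refine trdeg_adjoin_range_le fun f hf => ?_
  have hx0 : evalAt δ F x (MvPolynomial.rename Subtype.val f) = 0 := by
    rw [evalAt, MvPolynomial.aeval_rename]
    exact hf
  have hx'0 := hx.evalAt_eq_zero hx' hx0
  rwa [evalAt, MvPolynomial.aeval_rename] at hx'0

theorem IsGenericPoint.prolongationTrdeg_eq {X : Set (Fin n → K)} {x x' : Fin n → K}
    (hx : IsGenericPoint δ F X x) (hx' : IsGenericPoint δ F X x') (t : ℕ) :
    prolongationTrdeg δ F t x = prolongationTrdeg δ F t x' :=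
  le_antisymm (hx'.prolongationTrdeg_le hx.1 t) (hx.prolongationTrdeg_le hx'.1 t)

theorem exists_forall_isGenericPoint_prolongationTrdeg_eq (δ : Fin m → Derivation ℤ K K)
    (F : Subfield K) (X : Set (Fin n → K)) :
    ∃ g : ℕ → Cardinal, ∀ x, IsGenericPoint δ F X x → ∀ t, prolongationTrdeg δ F t x = g t := by
  by_cases hX : ∃ x₀, IsGenericPoint δ F X x₀
  · obtain ⟨x₀, hx₀⟩ := hX
    exact ⟨_, fun x hx => hx.prolongationTrdeg_eq hx₀⟩
  · exact ⟨0, fun x hx => (hX ⟨x, hx⟩).elim⟩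

theorem IsCodimOne.eventually_prolongationTrdeg_add_one_eq {X Y : Set (Fin n → K)}
    (h : IsCodimOne δ F X Y) {x y : Fin n → K} (hx : IsGenericPoint δ F X x)
    (hy : IsGenericPoint δ F Y y) :
    ∀ᶠ t in Filter.atTop, prolongationTrdeg δ F t y + 1 = prolongationTrdeg δ F t x := by
  obtain ⟨-, x₁, y₁, hx₁, hy₁, h⟩ := h
  simp only [hx.prolongationTrdeg_eq hx₁, hy.prolongationTrdeg_eq hy₁]
  exact Filter.eventually_atTop.2 h

end Points

end DeltaGeometry

open DeltaGeometry in
theorem proposition5p5_general {K : Type*} [Field K] [CharZero K] {m n : ℕ}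
    (δ : Fin m → Derivation ℤ K K)
    (hcomm : ∀ i j a, δ i (δ j a) = δ j (δ i a))
    (F : Subfield K) (hF : ∀ i, ∀ a ∈ F, δ i a ∈ F)
    (X : Set (Fin n → K)) (d : ℕ → ℕ) :
    ∃ ℓ : ℕ, ∀ x y : Fin n → K, IsGenericPoint δ F X x →
      (∀ᶠ t in Filter.atTop, prolongationTrdeg δ F t y + d t = prolongationTrdeg δ F t x) →
        ∀ t ≥ ℓ, prolongationTrdeg δ F t y + d t = prolongationTrdeg δ F t x := by
  obtain ⟨g, hg⟩ := exists_forall_isGenericPoint_prolongationTrdeg_eq δ F X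
  obtain ⟨ℓ, hℓ⟩ := exists_forall_ge_prolongationTrdeg_add_eq hcomm hF d g
  refine ⟨ℓ, fun x y hx => ?_⟩
  simp only [hg x hx]
  exact hℓ y

theorem proposition5p5 {K : Type*} [Field K] [CharZero K] {m n : ℕ}
    (δ : Fin m → Derivation ℤ K K)
    (hcomm : ∀ i j a, δ i (δ j a) = δ j (δ i a))
    (F : Subfield K) (hF : ∀ i, ∀ a ∈ F, δ i a ∈ F)
    (X : Set (Fin n → K)) (hX : DeltaGeometry.IsIrredDeltaVariety δ F X) :
    ∃ ℓ : ℕ, ∀ Y : Set (Fin n → K),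
      DeltaGeometry.IsIrredDeltaVariety δ F Y → DeltaGeometry.IsCodimOne δ F X Y →
      ∀ x y : Fin n → K,
        DeltaGeometry.IsGenericPoint δ F X x → DeltaGeometry.IsGenericPoint δ F Y y →
        ∀ t ≥ ℓ, DeltaGeometry.prolongationTrdeg δ F t y + 1 =
          DeltaGeometry.prolongationTrdeg δ F t x := by
  obtain ⟨ℓ, hℓ⟩ := proposition5p5_general δ hcomm F hF X 1
  exact ⟨ℓ, fun Y _ hY x y hx hy => by
    simpa using hℓ x y hx (by simpa using hY.eventually_prolongationTrdeg_add_one_eq hx hy)⟩
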